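/- Let $s=(s_i)_{i\in\mathbb{N}_0}$ be a real sequence. Let $L_s:\mathbb{R}[x]\to\mathbb{R}$ be the linear functional with $L_s(x^i)=s_i$ for all $i$, and let $\partial s$ be the sequence $(\partial s)_i := -L_s\big((x^i)'\big)$, i.e. $(\partial s)_0=0$ and $(\partial s)_i=-i\,s_{i-1}$ for $i\ge 1$. Call $f:[0,1]\to\mathbb{R}$ *piecewise continuous* if its (finite) one-sided limits exist at every point of $[0,1]$ and it has at most countably many points of discontinuity. Then the following are equivalent: (i) There exists a piecewise continuous function $f:[0,1]\to\mathbb{R}$ such that $s_i=\int_0^1 x^i f(x)\,\mathrm{d}x$ for all $i\in\mathbb{N}_0$, and the distributional derivative $f'$ on $\mathbb{R}$ of $f$ (extended by $0$ outside $[0,1]$) is a regular signed measure on $[0,1]$; that is, there are finite regular Borel measures $\mu_1,\mu_2$ on $[0,1]$ with $\int_0^1 f\varphi'\,\mathrm{d}x=-\int\varphi\,\mathrm{d}(\mu_1-\mu_2)$ for all $\varphi\in C_c^\infty(\mathbb{R})$. (ii) There exists a constant $C>0$ such that $$\sum_{k=0}^d\binom{d}{k}\,\big|L_s\big(x^k(1-x)^{d-k}\big)\big|<C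 \quad\text{and}\quad \sum_{k=0}^d\binom{d}{k}\,\big|L_{\partial s}\big(x^k(1-x)^{d-k}\big)\big|<C$$ for all $d\in\mathbb{N}_0$. If these hold and additionally $L_s\big(x^k(1-x)^l\big)\ge 0$ for all $k,l\in\mathbb{N}_0$, then every $f$ as in (i) satisfies $f(x)\ge 0$ at each of its points of continuity $x\in[0,1]$ (hence at all but countably many points of $[0,1]$), and $f$ in (i) can be chosen with $f\ge 0$ on all of $[0,1]$. -/

import Mathlib

open MeasureTheory Polynomial Set Filter Topology
open scoped ContDiff

/-- The Riesz functional `L_s : ℝ[x] → ℝ` of a real sequence `s`: the linear map with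
`L_s (x ^ i) = s i` for all `i`. -/
noncomputable def rieszFunctional (s : ℕ → ℝ) : ℝ[X] →ₗ[ℝ] ℝ :=
  (Polynomial.basisMonomials ℝ).constr ℝ s

theorem rieszFunctional_X_pow (s : ℕ → ℝ) (i : ℕ) : rieszFunctional s (X ^ i) = s i := by
  have h := (Polynomial.basisMonomials ℝ).constr_basis ℝ s i
  rw [Polynomial.coe_basisMonomials] at h
  rw [← Polynomial.monomial_one_right_eq_X_pow]
  exact h

/-- The derivative `∂s` of a real sequence `s`, `(∂s) i = - L_s ((x ^ i)')`; that is,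
`(∂s) 0 = 0` and `(∂s) i = - i * s (i - 1)` for `1 ≤ i`. -/
noncomputable def momentDeriv (s : ℕ → ℝ) (i : ℕ) : ℝ :=
  - rieszFunctional s (derivative (X ^ i))

theorem momentDeriv_zero (s : ℕ → ℝ) : momentDeriv s 0 = 0 := by
  simp [momentDeriv]

theorem momentDeriv_succ (s : ℕ → ℝ) (i : ℕ) : momentDeriv s (i + 1) = -((i + 1) * s i) := by
  rw [momentDeriv, derivative_X_pow, ← smul_eq_C_mul, map_smul]
  simp [rieszFunctional_X_pow]

/-- Piecewise continuity of `f` on `[0,1]` in the sense in which distribution functions of finite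
signed measures are piecewise continuous: all one-sided limits exist (as real numbers), and `f`
has at most countably many points of discontinuity in `[0,1]` (which are therefore jumps or
removable). Only the values of `f` on `[0,1]` matter. Such an `f` is bounded on `[0,1]` and
integrable there. -/
structure PiecewiseContinuousOnUnit (f : ℝ → ℝ) : Prop where
  right_limit : ∀ x ∈ Ico (0 : ℝ) 1, ∃ l : ℝ, Tendsto f (𝓝[>] x) (𝓝 l)
  left_limit : ∀ x ∈ Ioc (0 : ℝ) 1, ∃ l : ℝ, Tendsto f (𝓝[<] x) (𝓝 l)
  countable_discontinuities :
    {x ∈ Icc (0 : ℝ) 1 | ¬ ContinuousWithinAt f (Icc 0 1) x}.Countable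

/-- The distributional derivative of `f : [0,1] → ℝ` (extended by zero to a function on `ℝ`, so
that point masses at `0` and `1` are part of the derivative) is a regular signed measure
`μ₁ - μ₂` on `[0,1]`: for every test function `φ` on `ℝ`, `∫ f φ' = - ∫ φ d(μ₁ - μ₂)`. -/
def DistribDerivIsSignedMeasure (f : ℝ → ℝ) : Prop :=
  ∃ μ₁ μ₂ : Measure (Icc (0 : ℝ) 1), IsFiniteMeasure μ₁ ∧ IsFiniteMeasure μ₂ ∧
    μ₁.Regular ∧ μ₂.Regular ∧
    ∀ φ : ℝ → ℝ, ContDiff ℝ ∞ φ → HasCompactSupport φ →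
      ∫ x in (0 : ℝ)..1, f x * deriv φ x = -(∫ x, φ x ∂μ₁ - ∫ x, φ x ∂μ₂)

/-- `f` is a piecewise continuous density on `[0,1]` with moment sequence `s`, whose distributional
derivative is a regular signed measure on `[0,1]`. -/
structure IsRepresentingDensity (s : ℕ → ℝ) (f : ℝ → ℝ) : Prop where
  piecewise_continuous : PiecewiseContinuousOnUnit f
  moment : ∀ i : ℕ, s i = ∫ x in (0 : ℝ)..1, x ^ i * f x
  deriv_measure : DistribDerivIsSignedMeasure f

/-! From (i) to (ii): the Bernstein polynomials are nonnegative on `[0,1]` and sum to `1`, so the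
weighted sums are at most `∫ |f|` and the total mass of `μ₁` and `μ₂`.

From (ii) to (i), the bound on `∂s` alone suffices. Placing its Bernstein coefficients at the points
`k/d` gives discrete signed measures of bounded variation whose moments converge to those of `∂s`
(`tendsto_bernstein_moment`). Limits of their positive and negative parts are finite measures `μ`,
`ν` (`exists_measure_tendsto_hyperfilter`). Since `(∂s) 0 = 0`, these have equal mass, so the
difference `f` of their distribution functions has derivative `μ - ν` with no boundary term. Testing
with `x ^ (i + 1)` recovers `s i`.

For nonnegativity, Bernstein approximation extends the sign condition to `∫ g f ≥ 0` for continuous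
`g ≥ 0`; a tent function then localizes it at a point of continuity. -/

/-! ### Hausdorff's criterion: from bounded Bernstein coefficients to measures. -/

/-- Passing from `m` to `m + 1` multiplies the first ratio by `(k - m)/(d - m)`, which differs from
`k/d` by at most `m/(d - m)`, uniformly in `k ≤ d`. -/
theorem tendsto_choose_div_choose (m : ℕ) {ε : ℝ} (hε : 0 < ε) :
    ∀ᶠ d : ℕ in atTop, ∀ k ≤ d,
      |(k.choose m : ℝ) / (d.choose m : ℝ) - ((k : ℝ) / d) ^ m| ≤ ε := by
  induction m generalizing ε with
  | zero => simp [hε.le]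
  | succ m ih =>
    have h1 : Tendsto (fun d : ℕ => (m : ℝ) / ((d : ℝ) - m)) atTop (𝓝 0) :=
      tendsto_const_nhds.div_atTop
        (tendsto_atTop_add_const_right _ _ tendsto_natCast_atTop_atTop)
    filter_upwards [ih (half_pos hε), h1.eventually_lt_const (half_pos hε),
      eventually_gt_atTop m] with d hd hd1 hmd k hk
    have hmd' : (0 : ℝ) < (d : ℝ) - m := sub_pos.2 (by exact_mod_cast hmd)
    have hd0 : (0 : ℝ) < d := by exact_mod_cast (Nat.zero_le m).trans_lt hmd
    have hkd : (k : ℝ) ≤ d := by exact_mod_cast hk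
    have hc : (0 : ℝ) < d.choose m := by exact_mod_cast Nat.choose_pos hmd.le
    have hc1 : (0 : ℝ) < d.choose (m + 1) := by exact_mod_cast Nat.choose_pos hmd
    have key : ∀ n : ℕ, (n.choose (m + 1) : ℝ) * (m + 1) = n.choose m * ((n : ℝ) - m) := by
      intro n
      rcases lt_or_ge n m with h | h
      · simp [Nat.choose_eq_zero_of_lt h, Nat.choose_eq_zero_of_lt (h.trans (Nat.lt_succ_self m))]
      · have := Nat.choose_succ_right_eq n m
        rw [← Nat.cast_sub h]
        exact_mod_cast this
    have hrec : (k.choose (m + 1) : ℝ) / d.choose (m + 1)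
        = (k.choose m : ℝ) / d.choose m * (((k : ℝ) - m) / ((d : ℝ) - m)) := by
      rw [div_mul_div_comm, ← key, ← key, mul_div_mul_right]
      positivity
    set a : ℝ := (k.choose m : ℝ) / d.choose m
    have ha0 : 0 ≤ a := by positivity
    have ha1 : a ≤ 1 := by
      rw [div_le_one hc]
      exact_mod_cast Nat.choose_le_choose m hk
    set q : ℝ := (k : ℝ) / d
    have hq0 : 0 ≤ q := by positivity
    have hq1 : q ≤ 1 := (div_le_one hd0).2 hkd
    have hqr : |((k : ℝ) - m) / ((d : ℝ) - m) - q| ≤ ε / 2 := by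
      have : ((k : ℝ) - m) / ((d : ℝ) - m) - q = -(m / ((d : ℝ) - m) * (1 - q)) := by
        simp only [q]
        field_simp
        ring
      rw [this, abs_neg, abs_of_nonneg (mul_nonneg (by positivity) (by linarith))]
      refine le_trans ?_ hd1.le
      exact mul_le_of_le_one_right (by positivity) (by linarith)
    rw [hrec, pow_succ]
    have : a * (((k : ℝ) - m) / ((d : ℝ) - m)) - q ^ m * q
        = a * (((k : ℝ) - m) / ((d : ℝ) - m) - q) + (a - q ^ m) * q := by ring
    rw [this]
    refine (abs_add_le _ _).trans ?_
    rw [abs_mul, abs_mul, abs_of_nonneg ha0, abs_of_nonneg hq0]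
    have h2 := hd k hk
    nlinarith [abs_nonneg (((k : ℝ) - m) / ((d : ℝ) - m) - q), abs_nonneg (a - q ^ m)]

/-- This is the factorial moment of the binomial distribution: extracting `d.choose m * x ^ m`
leaves the expansion of `(x + (1 - x)) ^ (d - m)`. -/
theorem sum_choose_mul_bernstein {R : Type*} [CommRing R] {d m : ℕ} (hm : m ≤ d) (x : R) :
    ∑ k ∈ Finset.range (d + 1),
      ((k.choose m : ℕ) : R) * ((d.choose k : ℕ) * (x ^ k * (1 - x) ^ (d - k)))
      = (d.choose m : ℕ) * x ^ m := by
  obtain ⟨n, rfl⟩ := Nat.exists_eq_add_of_le hm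
  rw [add_assoc, Finset.sum_range_add]
  rw [Finset.sum_eq_zero fun k hk => by
    rw [Nat.choose_eq_zero_of_lt (Finset.mem_range.1 hk)]; simp, zero_add]
  have h := add_pow x (1 - x) n
  rw [add_sub_cancel, one_pow] at h
  refine Eq.trans (b := ((m + n).choose m : ℕ) * x ^ m * ∑ j ∈ Finset.range (n + 1),
      x ^ j * (1 - x) ^ (n - j) * (n.choose j : ℕ)) ?_ (by rw [← h, mul_one])
  rw [Finset.mul_sum]
  refine Finset.sum_congr rfl fun j hj => ?_
  have hc := Nat.choose_mul (n := m + n) (k := m + j) (s := m) (Nat.le_add_right _ _)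
  rw [Nat.add_sub_cancel_left, Nat.add_sub_cancel_left] at hc
  have hc' : (((m + n).choose (m + j) : ℕ) : R) * ((m + j).choose m : ℕ)
      = ((m + n).choose m : ℕ) * (n.choose j : ℕ) := by exact_mod_cast congrArg (Nat.cast : ℕ → R) hc
  rw [Nat.add_sub_add_left, pow_add]
  linear_combination x ^ m * x ^ j * (1 - x) ^ (n - j) * hc'

/-- With `k.choose m / d.choose m` in place of `(k/d) ^ m` the sum is exactly `L (X ^ m)` once `m ≤
d`; the replacement error is uniform in `k` and is multiplied by a total weight below `C`. -/
theorem tendsto_bernstein_moment (L : ℝ[X] →ₗ[ℝ] ℝ) {C : ℝ}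
    (hL : ∀ d : ℕ, ∑ k ∈ Finset.range (d + 1),
      (d.choose k : ℝ) * |L (X ^ k * (1 - X) ^ (d - k))| < C) (m : ℕ) :
    Tendsto (fun d : ℕ => ∑ k ∈ Finset.range (d + 1),
      (d.choose k : ℝ) * L (X ^ k * (1 - X) ^ (d - k)) * ((k : ℝ) / d) ^ m) atTop
      (𝓝 (L (X ^ m))) := by
  have hC : 0 < C := (Finset.sum_nonneg fun k _ => by positivity).trans_lt (hL 0)
  rw [Metric.tendsto_nhds]
  intro ε hε
  filter_upwards [tendsto_choose_div_choose m (show 0 < ε / (2 * C) by positivity),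
    eventually_ge_atTop m] with d hd hmd
  have hc : (0 : ℝ) < d.choose m := by exact_mod_cast Nat.choose_pos hmd
  have hid : L (X ^ m) = ∑ k ∈ Finset.range (d + 1),
      (d.choose k : ℝ) * L (X ^ k * (1 - X) ^ (d - k)) * ((k.choose m : ℝ) / d.choose m) := by
    have h := congrArg L (sum_choose_mul_bernstein hmd (X : ℝ[X]))
    simp only [← nsmul_eq_mul, map_sum, map_nsmul] at h
    simp only [nsmul_eq_mul] at h
    rw [eq_comm, ← mul_right_inj' hc.ne', ← h, Finset.mul_sum]
    refine Finset.sum_congr rfl fun k _ => ?_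
    field_simp
  rw [hid, Real.dist_eq, ← Finset.sum_sub_distrib]
  calc _ ≤ ∑ k ∈ Finset.range (d + 1),
        ((d.choose k : ℝ) * |L (X ^ k * (1 - X) ^ (d - k))|) * (ε / (2 * C)) := by
        refine (Finset.abs_sum_le_sum_abs _ _).trans (Finset.sum_le_sum fun k hk => ?_)
        rw [← mul_sub, abs_mul, abs_mul, Nat.abs_cast, abs_sub_comm]
        exact mul_le_mul_of_nonneg_left (hd k (Nat.lt_succ_iff.1 (Finset.mem_range.1 hk)))
          (by positivity)
    _ = (∑ k ∈ Finset.range (d + 1),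
        (d.choose k : ℝ) * |L (X ^ k * (1 - X) ^ (d - k))|) * (ε / (2 * C)) := by
        rw [Finset.sum_mul]
    _ ≤ C * (ε / (2 * C)) := mul_le_mul_of_nonneg_right (hL d).le (by positivity)
    _ = ε / 2 := by field_simp
    _ < ε := half_lt_self hε

/-- Along an ultrafilter every bounded real sequence converges, so the limits form a positive linear
functional without extracting subsequences; Riesz–Markov represents it. -/
theorem exists_measure_tendsto_hyperfilter (w : ℕ → ℕ → ℝ) (hw : ∀ d k, 0 ≤ w d k) {C : ℝ}
    (hC : ∀ d, ∑ k ∈ Finset.range (d + 1), w d k ≤ C) :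
    ∃ μ : Measure (Icc (0 : ℝ) 1), IsFiniteMeasure μ ∧ μ.Regular ∧ ∀ g : C(Icc (0 : ℝ) 1, ℝ),
      Tendsto (fun d : ℕ => ∑ k : Fin (d + 1), w d k * g (bernstein.z k)) (hyperfilter ℕ)
        (𝓝 (∫ x, g x ∂μ)) := by
  let S : C(Icc (0 : ℝ) 1, ℝ) → ℕ → ℝ := fun g d => ∑ k : Fin (d + 1), w d k * g (bernstein.z k)
  have hlim : ∀ g, ∃ l, Tendsto (S g) (hyperfilter ℕ) (𝓝 l) := by
    intro g
    have hb : ∀ d, S g d ∈ Icc (-(C * ‖g‖)) (C * ‖g‖) := by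
      intro d
      rw [mem_Icc, ← abs_le]
      calc |S g d| ≤ ∑ k : Fin (d + 1), w d k * ‖g‖ := by
            refine (Finset.abs_sum_le_sum_abs _ _).trans (Finset.sum_le_sum fun k _ => ?_)
            rw [abs_mul, abs_of_nonneg (hw _ _)]
            exact mul_le_mul_of_nonneg_left (g.norm_coe_le_norm _) (hw _ _)
        _ ≤ C * ‖g‖ := by
            rw [← Finset.sum_mul]
            refine mul_le_mul_of_nonneg_right ?_ (norm_nonneg _)
            rw [← Finset.sum_range (fun k => w d k)]
            exact hC d
    obtain ⟨l, -, hl⟩ := isCompact_Icc.ultrafilter_le_nhds'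
      ((hyperfilter ℕ).map (S g)) (by
        rw [Ultrafilter.mem_map]; exact Filter.univ_mem' hb)
    exact ⟨l, hl⟩
  choose Λ hΛ using hlim
  let Φ : CompactlySupportedContinuousMap (Icc (0 : ℝ) 1) ℝ →ₗ[ℝ] ℝ :=
    { toFun := fun g => Λ g.toContinuousMap
      map_add' := fun g h => tendsto_nhds_unique (hΛ _)
        (((hΛ g.toContinuousMap).add (hΛ h.toContinuousMap)).congr fun d => by
          simp [S, mul_add, Finset.sum_add_distrib])
      map_smul' := fun c g => tendsto_nhds_unique (hΛ _)
        (((hΛ g.toContinuousMap).const_mul c).congr fun d => by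
          simp [S, Finset.mul_sum, mul_left_comm]) }
  let Ψ : CompactlySupportedContinuousMap (Icc (0 : ℝ) 1) ℝ →ₚ[ℝ] ℝ := PositiveLinearMap.mk₀ Φ fun g hg =>
    ge_of_tendsto' (hΛ g.toContinuousMap) fun d =>
      Finset.sum_nonneg fun k _ => mul_nonneg (hw _ _) (hg _)
  refine ⟨RealRMK.rieszMeasure Ψ, inferInstance, inferInstance, fun g => ?_⟩
  have h := RealRMK.integral_rieszMeasure Ψ (CompactlySupportedContinuousMap.continuousMapEquiv g)
  have h2 : Ψ (CompactlySupportedContinuousMap.continuousMapEquiv g) = Λ g := rfl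
  rw [h2] at h
  exact h ▸ hΛ g

/-- A linear functional on polynomials whose Bernstein coefficients have bounded variation is
integration against a difference of two finite regular measures on the unit interval. -/
theorem exists_measures_of_bounded_variation (L : ℝ[X] →ₗ[ℝ] ℝ) {C : ℝ}
    (hL : ∀ d : ℕ, ∑ k ∈ Finset.range (d + 1),
      (d.choose k : ℝ) * |L (X ^ k * (1 - X) ^ (d - k))| < C) :
    ∃ μ₁ μ₂ : Measure (Icc (0 : ℝ) 1), IsFiniteMeasure μ₁ ∧ IsFiniteMeasure μ₂ ∧
      μ₁.Regular ∧ μ₂.Regular ∧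
      ∀ m : ℕ, L (X ^ m) = ∫ x, (x : ℝ) ^ m ∂μ₁ - ∫ x, (x : ℝ) ^ m ∂μ₂ := by
  let c : ℕ → ℕ → ℝ := fun d k => (d.choose k : ℝ) * L (X ^ k * (1 - X) ^ (d - k))
  have hc : ∀ d, ∑ k ∈ Finset.range (d + 1), |c d k| ≤ C := fun d => by
    simpa [c, abs_mul] using (hL d).le
  obtain ⟨μ₁, hf₁, hr₁, h₁⟩ := exists_measure_tendsto_hyperfilter (fun d k => max (c d k) 0)
    (fun _ _ => le_max_right _ _) (C := C)
    (fun d => (Finset.sum_le_sum fun k _ => max_le (le_abs_self _) (abs_nonneg _)).trans (hc d))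
  obtain ⟨μ₂, hf₂, hr₂, h₂⟩ := exists_measure_tendsto_hyperfilter (fun d k => max (-c d k) 0)
    (fun _ _ => le_max_right _ _) (C := C)
    (fun d => (Finset.sum_le_sum fun k _ => max_le (neg_le_abs _) (abs_nonneg _)).trans (hc d))
  refine ⟨μ₁, μ₂, hf₁, hf₂, hr₁, hr₂, fun m => ?_⟩
  let g : C(Icc (0 : ℝ) 1, ℝ) := ⟨fun x => (x : ℝ) ^ m, by fun_prop⟩
  refine tendsto_nhds_unique
    ((tendsto_bernstein_moment L hL m).mono_left Nat.hyperfilter_le_atTop)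
    (((h₁ g).sub (h₂ g)).congr fun d => ?_)
  rw [← Finset.sum_sub_distrib, Finset.sum_range]
  refine Finset.sum_congr rfl fun k _ => ?_
  have : max (c d k) 0 - max (-c d k) 0 = c d k := by
    rcases le_total (c d k) 0 with h | h <;> simp [h]
  rw [← sub_mul, this]
  rfl

/-! ### Boundedness and integrability of piecewise continuous functions. -/

theorem PiecewiseContinuousOnUnit.exists_bound {f : ℝ → ℝ} (hf : PiecewiseContinuousOnUnit f) :
    ∃ M : ℝ, ∀ x ∈ Icc (0 : ℝ) 1, |f x| ≤ M := by
  refine isCompact_Icc.induction_on (p := fun s => ∃ M : ℝ, ∀ x ∈ s, |f x| ≤ M) ⟨0, by simp⟩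
    (fun s t hst ⟨M, hM⟩ => ⟨M, fun x hx => hM x (hst hx)⟩)
    (fun s t ⟨M, hM⟩ ⟨N, hN⟩ => ⟨max M N, ?_⟩) fun x hx => ?_
  · rintro x (h | h)
    · exact (hM x h).trans (le_max_left _ _)
    · exact (hN x h).trans (le_max_right _ _)
  · have hr : ∃ M : ℝ, ∀ᶠ y in 𝓝[>] x, y ∈ Icc (0 : ℝ) 1 → |f y| ≤ M := by
      rcases hx.2.eq_or_lt with h | h
      · refine ⟨0, ?_⟩
        filter_upwards [self_mem_nhdsWithin] with y hy hy1
        exact absurd hy1.2 (not_le.2 (h ▸ hy))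
      · obtain ⟨l, hl⟩ := hf.right_limit x ⟨hx.1, h⟩
        refine ⟨|l| + 1, ?_⟩
        filter_upwards [hl.abs.eventually_lt_const (lt_add_one _)] with y hy _ using hy.le
    have hl : ∃ M : ℝ, ∀ᶠ y in 𝓝[<] x, y ∈ Icc (0 : ℝ) 1 → |f y| ≤ M := by
      rcases hx.1.eq_or_lt with h | h
      · refine ⟨0, ?_⟩
        filter_upwards [self_mem_nhdsWithin] with y hy hy1
        exact absurd hy1.1 (not_le.2 (h ▸ hy))
      · obtain ⟨l, hl⟩ := hf.left_limit x ⟨h, hx.2⟩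
        refine ⟨|l| + 1, ?_⟩
        filter_upwards [hl.abs.eventually_lt_const (lt_add_one _)] with y hy _ using hy.le
    obtain ⟨M, hM⟩ := hr
    obtain ⟨N, hN⟩ := hl
    rw [eventually_nhdsWithin_iff] at hM hN
    refine ⟨_, inter_mem_nhdsWithin _ (hM.and hN), max |f x| (max M N), ?_⟩
    rintro y ⟨hy, hy1, hy2⟩
    rcases lt_trichotomy y x with h | rfl | h
    · exact (hy2 h hy).trans ((le_max_right _ _).trans (le_max_right _ _))
    · exact le_max_left _ _
    · exact (hy1 h hy).trans ((le_max_left _ _).trans (le_max_right _ _))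

theorem PiecewiseContinuousOnUnit.ae_continuousWithinAt {f : ℝ → ℝ}
    (hf : PiecewiseContinuousOnUnit f) :
    ∀ᵐ x, x ∈ Icc (0 : ℝ) 1 → ContinuousWithinAt f (Icc 0 1) x := by
  filter_upwards [hf.countable_discontinuities.ae_notMem volume] with x hx hx1
  by_contra h
  exact hx ⟨hx1, h⟩

theorem PiecewiseContinuousOnUnit.integrableOn {f : ℝ → ℝ} (hf : PiecewiseContinuousOnUnit f) :
    IntegrableOn f (Icc 0 1) := by
  obtain ⟨M, hM⟩ := hf.exists_bound
  set S := {x ∈ Icc (0 : ℝ) 1 | ¬ ContinuousWithinAt f (Icc 0 1) x} with hS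
  have hcont : ContinuousOn f (Icc 0 1 \ S) := by
    rintro x ⟨hx, hxS⟩
    have : ContinuousWithinAt f (Icc 0 1) x := by
      by_contra h
      exact hxS ⟨hx, h⟩
    exact this.mono sdiff_subset
  have hmeas : AEStronglyMeasurable f (volume.restrict (Icc (0 : ℝ) 1)) := by
    have h := hcont.aestronglyMeasurable (μ := volume)
      (measurableSet_Icc.diff hf.countable_discontinuities.measurableSet)
    rwa [Measure.restrict_congr_set
      (sdiff_null_ae_eq_self (hf.countable_discontinuities.measure_zero volume))] at h
  exact Integrable.of_bound hmeas M
    ((ae_restrict_iff' measurableSet_Icc).2 (Eventually.of_forall hM))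

theorem PiecewiseContinuousOnUnit.intervalIntegrable {f : ℝ → ℝ}
    (hf : PiecewiseContinuousOnUnit f) : IntervalIntegrable f volume 0 1 :=
  (intervalIntegrable_iff_integrableOn_Icc_of_le zero_le_one).2 hf.integrableOn

/-! ### Representing densities satisfy the Bernstein bounds. -/

theorem rieszFunctional_momentDeriv (s : ℕ → ℝ) (p : ℝ[X]) :
    rieszFunctional (momentDeriv s) p = -rieszFunctional s (derivative p) := by
  have : rieszFunctional (momentDeriv s) = -(rieszFunctional s ∘ₗ derivative) := by
    refine (Polynomial.basisMonomials ℝ).ext fun i => ?_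
    rw [coe_basisMonomials]
    beta_reduce
    rw [monomial_one_right_eq_X_pow, rieszFunctional_X_pow]
    rfl
  rw [this]
  rfl

theorem rieszFunctional_eq_integral {s : ℕ → ℝ} {f : ℝ → ℝ} (hf : IntervalIntegrable f volume 0 1)
    (hs : ∀ i : ℕ, s i = ∫ x in (0 : ℝ)..1, x ^ i * f x) (p : ℝ[X]) :
    rieszFunctional s p = ∫ x in (0 : ℝ)..1, p.eval x * f x := by
  have hint : ∀ q : ℝ[X], IntervalIntegrable (fun x => q.eval x * f x) volume 0 1 := fun q =>
    hf.continuousOn_mul q.continuous.continuousOn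
  induction p using Polynomial.induction_on' with
  | add p q hp hq =>
    simp only [map_add, hp, hq, eval_add, add_mul]
    rw [intervalIntegral.integral_add (hint p) (hint q)]
  | monomial n a =>
    rw [← C_mul_X_pow_eq_monomial, ← smul_eq_C_mul, map_smul, rieszFunctional_X_pow, hs]
    simp [mul_assoc]

theorem sum_choose_mul_abs_integral_le {α : Type*} [MeasurableSpace α] {ν : Measure α}
    {u h : α → ℝ} (hu : AEStronglyMeasurable u ν) (hu01 : ∀ᵐ x ∂ν, u x ∈ Icc (0 : ℝ) 1)
    (hh : Integrable h ν) (d : ℕ) :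
    ∑ k ∈ Finset.range (d + 1), (d.choose k : ℝ) * |∫ x, u x ^ k * (1 - u x) ^ (d - k) * h x ∂ν|
      ≤ ∫ x, |h x| ∂ν := by
  have hint : ∀ k, Integrable (fun x => u x ^ k * (1 - u x) ^ (d - k) * |h x|) ν := fun k => by
    refine hh.abs.bdd_mul (c := 1) (by fun_prop) ?_
    filter_upwards [hu01] with x hx
    have h1 : 0 ≤ 1 - u x := sub_nonneg.2 hx.2
    rw [Real.norm_of_nonneg (mul_nonneg (pow_nonneg hx.1 _) (pow_nonneg h1 _))]
    exact mul_le_one₀ (pow_le_one₀ hx.1 hx.2) (pow_nonneg h1 _)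
      (pow_le_one₀ h1 (by linarith [hx.1]))
  calc _ ≤ ∑ k ∈ Finset.range (d + 1),
        (d.choose k : ℝ) * ∫ x, u x ^ k * (1 - u x) ^ (d - k) * |h x| ∂ν := by
        refine Finset.sum_le_sum fun k _ => mul_le_mul_of_nonneg_left ?_ (Nat.cast_nonneg _)
        refine abs_integral_le_integral_abs.trans (integral_congr_ae ?_).le
        filter_upwards [hu01] with x hx
        rw [abs_mul, abs_of_nonneg
          (mul_nonneg (pow_nonneg hx.1 _) (pow_nonneg (sub_nonneg.2 hx.2) _))]
    _ = ∫ x, ∑ k ∈ Finset.range (d + 1),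
        (d.choose k : ℝ) * (u x ^ k * (1 - u x) ^ (d - k) * |h x|) ∂ν := by
        rw [integral_finsetSum _ fun k _ => (hint k).const_mul _]
        simp only [integral_const_mul]
    _ = ∫ x, |h x| ∂ν := by
        refine integral_congr_ae (Eventually.of_forall fun x => ?_)
        have h1 := add_pow (u x) (1 - u x) d
        rw [add_sub_cancel, one_pow] at h1
        calc _ = (∑ k ∈ Finset.range (d + 1),
              u x ^ k * (1 - u x) ^ (d - k) * (d.choose k : ℝ)) * |h x| := by
              rw [Finset.sum_mul]
              exact Finset.sum_congr rfl fun k _ => by ring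
          _ = |h x| := by rw [← h1, one_mul]

/-- A polynomial agrees near the unit interval with a test function. -/
theorem exists_testFunction_eq_polynomial (p : ℝ[X]) :
    ∃ φ : ℝ → ℝ, ContDiff ℝ ∞ φ ∧ HasCompactSupport φ ∧ ∀ x ∈ Icc (0 : ℝ) 1,
      φ x = p.eval x ∧ deriv φ x = (derivative p).eval x := by
  -- The open ball of radius `1` about `1/2` contains `[0,1]`, so derivatives agree at the endpoints
  -- too.
  let b : ContDiffBump (1 / 2 : ℝ) := ⟨1, 2, one_pos, one_lt_two⟩
  have hb : ∀ x ∈ Icc (0 : ℝ) 1, (fun x => b x * p.eval x) =ᶠ[𝓝 x] fun x => p.eval x := by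
    intro x hx
    have hx' : x ∈ Metric.ball (1 / 2 : ℝ) b.rIn := by
      rw [Metric.mem_ball, Real.dist_eq, abs_lt]
      change -1 < x - 1 / 2 ∧ x - 1 / 2 < 1
      constructor <;> linarith [hx.1, hx.2]
    filter_upwards [b.eventuallyEq_one_of_mem_ball hx'] with y hy
    simp [hy]
  have hp : ContDiff ℝ ∞ fun x : ℝ => p.eval x := p.contDiff_aeval ∞
  refine ⟨fun x => b x * p.eval x, b.contDiff.mul hp, b.hasCompactSupport.mul_right,
    fun x hx => ⟨(hb x hx).self_of_nhds, ?_⟩⟩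
  rw [(hb x hx).deriv_eq, Polynomial.deriv]

theorem IsRepresentingDensity.exists_bound {s : ℕ → ℝ} {f : ℝ → ℝ}
    (hf : IsRepresentingDensity s f) :
    ∃ C : ℝ, 0 < C ∧ ∀ d : ℕ,
      ∑ k ∈ Finset.range (d + 1),
        (d.choose k : ℝ) * |rieszFunctional s (X ^ k * (1 - X) ^ (d - k))| < C ∧
      ∑ k ∈ Finset.range (d + 1),
        (d.choose k : ℝ) * |rieszFunctional (momentDeriv s) (X ^ k * (1 - X) ^ (d - k))| < C := by
  have hint := hf.piecewise_continuous.intervalIntegrable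
  obtain ⟨μ₁, μ₂, _, _, -, -, hμ⟩ := hf.deriv_measure
  have hderiv : ∀ p : ℝ[X], rieszFunctional (momentDeriv s) p
      = ∫ x, p.eval (x : ℝ) ∂μ₁ - ∫ x, p.eval (x : ℝ) ∂μ₂ := by
    intro p
    obtain ⟨φ, hφ, hφc, hφp⟩ := exists_testFunction_eq_polynomial p
    have h := hμ φ hφ hφc
    rw [integral_congr_ae (g := fun x : Icc (0 : ℝ) 1 => p.eval (x : ℝ))
        (Eventually.of_forall fun x => (hφp x x.2).1),
      integral_congr_ae (g := fun x : Icc (0 : ℝ) 1 => p.eval (x : ℝ)) (μ := μ₂)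
        (Eventually.of_forall fun x => (hφp x x.2).1),
      intervalIntegral.integral_congr (g := fun x => (derivative p).eval x * f x) fun x hx => by
        rw [uIcc_of_le zero_le_one] at hx
        simp only [(hφp x hx).2, mul_comm]] at h
    rw [rieszFunctional_momentDeriv, rieszFunctional_eq_integral hint hf.moment, h, neg_neg]
  have hmeas : ∀ (μ : Measure (Icc (0 : ℝ) 1)) [IsFiniteMeasure μ] (d : ℕ),
      ∑ k ∈ Finset.range (d + 1),
        (d.choose k : ℝ) * |∫ x, (X ^ k * (1 - X) ^ (d - k) : ℝ[X]).eval (x : ℝ) ∂μ|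
        ≤ μ.real univ := by
    intro μ _ d
    have := sum_choose_mul_abs_integral_le (ν := μ) (u := fun x => (x : ℝ)) (h := fun _ => 1)
      (by fun_prop) (Eventually.of_forall fun x => x.2) (integrable_const 1) d
    simpa using this
  -- The summand `1` makes the bounds strict.
  refine ⟨(∫ x in Ioc (0 : ℝ) 1, |f x|) + μ₁.real univ + μ₂.real univ + 1, ?_, fun d => ⟨?_, ?_⟩⟩
  · have : 0 ≤ ∫ x in Ioc (0 : ℝ) 1, |f x| := integral_nonneg fun x => abs_nonneg _
    positivity
  · have h := sum_choose_mul_abs_integral_le (ν := volume.restrict (Ioc (0 : ℝ) 1)) (u := id)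
      (h := f) (by fun_prop)
      ((ae_restrict_iff' measurableSet_Ioc).2
        (Eventually.of_forall fun x hx => Ioc_subset_Icc_self hx)) hint.1 d
    have h1 : 0 ≤ μ₁.real univ := measureReal_nonneg
    have h2 : 0 ≤ μ₂.real univ := measureReal_nonneg
    simp only [rieszFunctional_eq_integral hint hf.moment,
      intervalIntegral.integral_of_le zero_le_one, eval_mul, eval_pow, eval_X, eval_sub, eval_one]
    simp only [id] at h
    linarith
  · have h0 : 0 ≤ ∫ x in Ioc (0 : ℝ) 1, |f x| := integral_nonneg fun x => abs_nonneg _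
    have h1 := hmeas μ₁ d
    have h2 := hmeas μ₂ d
    simp only [hderiv]
    refine lt_of_le_of_lt (Finset.sum_le_sum fun k _ =>
      mul_le_mul_of_nonneg_left (abs_sub _ _) (Nat.cast_nonneg _)) ?_
    simp only [mul_add, Finset.sum_add_distrib]
    linarith

/-! ### Distribution functions and the construction of the density. -/

/-- The left-continuous distribution function of a measure on the unit interval. -/
noncomputable def distFun (μ : Measure (Icc (0 : ℝ) 1)) (x : ℝ) : ℝ :=
  μ.real {y | (y : ℝ) < x}

theorem monotone_distFun (μ : Measure (Icc (0 : ℝ) 1)) [IsFiniteMeasure μ] :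
    Monotone (distFun μ) := fun _ _ hxy => measureReal_mono fun _ hz => lt_of_lt_of_le hz hxy

theorem piecewiseContinuousOnUnit_distFun_sub (μ ν : Measure (Icc (0 : ℝ) 1)) [IsFiniteMeasure μ]
    [IsFiniteMeasure ν] : PiecewiseContinuousOnUnit fun x => distFun μ x - distFun ν x where
  right_limit x _ := ⟨_, ((monotone_distFun μ).tendsto_nhdsGT x).sub
    ((monotone_distFun ν).tendsto_nhdsGT x)⟩
  left_limit x _ := ⟨_, ((monotone_distFun μ).tendsto_nhdsLT x).sub
    ((monotone_distFun ν).tendsto_nhdsLT x)⟩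
  countable_discontinuities := by
    refine ((monotone_distFun μ).countable_not_continuousAt.union
      (monotone_distFun ν).countable_not_continuousAt).mono fun x hx => ?_
    by_contra h
    simp only [mem_union, mem_ofPred_eq, not_or, not_not] at h
    exact hx.2 (h.1.sub h.2).continuousWithinAt

/-- Fubini on the region `y < x`. -/
theorem intervalIntegral_distFun_mul (μ : Measure (Icc (0 : ℝ) 1)) [IsFiniteMeasure μ]
    {h : ℝ → ℝ} (hh : Continuous h) :
    ∫ x in (0 : ℝ)..1, distFun μ x * h x = ∫ y, (∫ x in (y : ℝ)..1, h x) ∂μ := by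
  have hint : Integrable h (volume.restrict (Ioc (0 : ℝ) 1)) :=
    (hh.intervalIntegrable 0 1).1
  have hmeas : MeasurableSet {p : ℝ × Icc (0 : ℝ) 1 | (p.2 : ℝ) < p.1} :=
    measurableSet_lt (by fun_prop) (by fun_prop)
  have hprod : Integrable (Function.uncurry fun (x : ℝ) (y : Icc (0 : ℝ) 1) =>
      {p : ℝ × Icc (0 : ℝ) 1 | (p.2 : ℝ) < p.1}.indicator (fun p => h p.1) (x, y))
      ((volume.restrict (Ioc (0 : ℝ) 1)).prod μ) :=
    (hint.comp_fst μ).indicator hmeas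
  have hswap := integral_integral_swap hprod
  rw [intervalIntegral.integral_of_le zero_le_one]
  convert! hswap using 1
  · refine integral_congr_ae (Eventually.of_forall fun x => ?_)
    have hs : MeasurableSet {y : Icc (0 : ℝ) 1 | (y : ℝ) < x} :=
      measurableSet_lt (by fun_prop) (by fun_prop)
    change _ = ∫ y, {y : Icc (0 : ℝ) 1 | (y : ℝ) < x}.indicator (fun _ => h x) y ∂μ
    rw [integral_indicator_const _ hs]
    rfl
  · refine integral_congr_ae (Eventually.of_forall fun y => ?_)
    change _ = ∫ x, (Ioi (y : ℝ)).indicator h x ∂volume.restrict (Ioc (0 : ℝ) 1)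
    rw [integral_indicator measurableSet_Ioi, Measure.restrict_restrict measurableSet_Ioi]
    have : Ioi (y : ℝ) ∩ Ioc 0 1 = Ioc (y : ℝ) 1 := by
      ext x
      simp only [mem_inter_iff, mem_Ioi, mem_Ioc]
      exact ⟨fun h => ⟨h.1, h.2.2⟩, fun h => ⟨h.1, y.2.1.trans_lt h.1, h.2⟩⟩
    rw [this, ← intervalIntegral.integral_of_le y.2.2]

/-- Each measure contributes a boundary term, its mass times `φ 1`; equal masses make these cancel.
Compact support is not required, so monomials are admissible. -/
theorem intervalIntegral_distFun_sub_mul_deriv (μ ν : Measure (Icc (0 : ℝ) 1)) [IsFiniteMeasure μ]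
    [IsFiniteMeasure ν] (hμν : μ.real univ = ν.real univ) {φ : ℝ → ℝ} (hφ : ContDiff ℝ 1 φ) :
    ∫ x in (0 : ℝ)..1, (distFun μ x - distFun ν x) * deriv φ x
      = -(∫ x, φ x ∂μ - ∫ x, φ x ∂ν) := by
  have hc : Continuous (deriv φ) := hφ.continuous_deriv le_rfl
  have hint : ∀ (ρ : Measure (Icc (0 : ℝ) 1)) [IsFiniteMeasure ρ],
      IntervalIntegrable (fun x => distFun ρ x * deriv φ x) volume 0 1 := fun ρ _ =>
    (monotone_distFun ρ).intervalIntegrable.mul_continuousOn hc.continuousOn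
  have key : ∀ (ρ : Measure (Icc (0 : ℝ) 1)) [IsFiniteMeasure ρ],
      ∫ x in (0 : ℝ)..1, distFun ρ x * deriv φ x = ρ.real univ * φ 1 - ∫ x, φ x ∂ρ := by
    intro ρ _
    have hi : Integrable (fun y : Icc (0 : ℝ) 1 => φ y) ρ :=
      (hφ.continuous.comp continuous_subtype_val).integrable_of_hasCompactSupport
        (HasCompactSupport.of_compactSpace _)
    rw [intervalIntegral_distFun_mul ρ hc]
    simp_rw [fun y : ℝ => intervalIntegral.integral_deriv_eq_sub' (a := y) (b := 1) φ rfl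
      (fun x _ => hφ.differentiable one_ne_zero x) hc.continuousOn]
    rw [integral_sub (integrable_const _) hi]
    simp
  simp only [sub_mul]
  rw [intervalIntegral.integral_sub (hint μ) (hint ν), key, key, hμν]
  ring

theorem exists_isRepresentingDensity {s : ℕ → ℝ} {C : ℝ}
    (hs : ∀ d : ℕ, ∑ k ∈ Finset.range (d + 1),
      (d.choose k : ℝ) * |rieszFunctional (momentDeriv s) (X ^ k * (1 - X) ^ (d - k))| < C) :
    ∃ f : ℝ → ℝ, IsRepresentingDensity s f := by
  obtain ⟨μ, ν, _, _, hμr, hνr, h⟩ := exists_measures_of_bounded_variation _ hs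
  simp only [rieszFunctional_X_pow] at h
  have hμν : μ.real univ = ν.real univ := by
    have := h 0
    rw [momentDeriv_zero] at this
    simp only [pow_zero, integral_const, smul_eq_mul, mul_one] at this
    linarith
  refine ⟨fun x => distFun μ x - distFun ν x, piecewiseContinuousOnUnit_distFun_sub μ ν,
    fun i => ?_, μ, ν, inferInstance, inferInstance, hμr, hνr, fun φ hφ _ =>
      intervalIntegral_distFun_sub_mul_deriv μ ν hμν (hφ.of_le (by exact_mod_cast le_top))⟩
  have h1 := intervalIntegral_distFun_sub_mul_deriv μ ν hμν (φ := fun x => x ^ (i + 1))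
    (by fun_prop)
  rw [← h, momentDeriv_succ, neg_neg] at h1
  have h2 : ∫ x in (0 : ℝ)..1, (distFun μ x - distFun ν x) * deriv (fun x => x ^ (i + 1)) x
      = (i + 1) * ∫ x in (0 : ℝ)..1, x ^ i * (distFun μ x - distFun ν x) := by
    rw [← intervalIntegral.integral_const_mul]
    refine intervalIntegral.integral_congr fun x _ => ?_
    simp
    ring
  rw [h2] at h1
  exact (mul_left_cancel₀ (by positivity) h1).symm

/-! ### Nonnegativity of the density. -/

theorem integral_mul_nonneg_of_rieszFunctional_nonneg {s : ℕ → ℝ} {f : ℝ → ℝ}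
    (hf : IntervalIntegrable f volume 0 1)
    (hs : ∀ i : ℕ, s i = ∫ x in (0 : ℝ)..1, x ^ i * f x)
    (hpos : ∀ k l : ℕ, 0 ≤ rieszFunctional s (X ^ k * (1 - X) ^ l))
    {g : ℝ → ℝ} (hg : Continuous g) (hg0 : ∀ x ∈ Icc (0 : ℝ) 1, 0 ≤ g x) :
    0 ≤ ∫ x in (0 : ℝ)..1, g x * f x := by
  let G : C(unitInterval, ℝ) := ⟨fun x => g x, by fun_prop⟩
  have hG := bernsteinApproximation_uniform G
  have hGx : ∀ x : unitInterval,
      Tendsto (fun n => bernsteinApproximation n G x) atTop (𝓝 (G x)) := fun x =>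
    ((continuous_eval_const x).tendsto G).comp hG
  let P : ℕ → ℝ[X] := fun n => ∑ k : Fin (n + 1),
    (n.choose k * G (bernstein.z k)) • (X ^ (k : ℕ) * (1 - X) ^ (n - k))
  have hP : ∀ n, ∀ x : unitInterval, (P n).eval (x : ℝ) = bernsteinApproximation n G x := by
    intro n x
    rw [bernsteinApproximation.apply, eval_finsetSum]
    refine Finset.sum_congr rfl fun k _ => ?_
    simp [bernstein_apply]
    ring
  have hPpos : ∀ n, 0 ≤ ∫ x in Ioc (0 : ℝ) 1, (P n).eval x * f x := by
    intro n
    rw [← intervalIntegral.integral_of_le zero_le_one, ← rieszFunctional_eq_integral hf hs,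
      map_sum]
    refine Finset.sum_nonneg fun k _ => ?_
    rw [map_smul]
    exact mul_nonneg (mul_nonneg (Nat.cast_nonneg _) (hg0 _ (bernstein.z k).2)) (hpos _ _)
  rw [intervalIntegral.integral_of_le zero_le_one]
  refine ge_of_tendsto' (tendsto_integral_filter_of_dominated_convergence
    (l := atTop) (F := fun n x => (P n).eval x * f x) (fun x => (‖G‖ + 1) * |f x|) (Eventually.of_forall fun n => ?_) ?_ (hf.1.abs.const_mul _) ?_)
    hPpos
  · exact (P n).continuous.aestronglyMeasurable.mul hf.1.aestronglyMeasurable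
  · filter_upwards [hG.norm.eventually_lt_const (lt_add_one ‖G‖)] with n hn
    refine (ae_restrict_iff' measurableSet_Ioc).2 (Eventually.of_forall fun x hx => ?_)
    rw [norm_mul, hP n ⟨x, Ioc_subset_Icc_self hx⟩]
    exact mul_le_mul_of_nonneg_right
      (((bernsteinApproximation n G).norm_coe_le_norm _).trans hn.le) (abs_nonneg _)
  · refine (ae_restrict_iff' measurableSet_Ioc).2 (Eventually.of_forall fun x hx => ?_)
    have := hGx ⟨x, Ioc_subset_Icc_self hx⟩
    simp only [← hP] at this
    exact this.mul_const _

theorem IsRepresentingDensity.nonneg_of_continuousWithinAt {s : ℕ → ℝ} {f : ℝ → ℝ}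
    (hf : IsRepresentingDensity s f)
    (hpos : ∀ k l : ℕ, 0 ≤ rieszFunctional s (X ^ k * (1 - X) ^ l))
    {x : ℝ} (hx : x ∈ Icc (0 : ℝ) 1) (hc : ContinuousWithinAt f (Icc 0 1) x) : 0 ≤ f x := by
  by_contra! hneg
  obtain ⟨δ, hδ, h⟩ := Metric.mem_nhdsWithin_iff.1
    (hc.eventually_lt_const (show f x < f x / 2 by linarith))
  have hint := hf.piecewise_continuous.intervalIntegrable
  -- On `[0,1]` this tent is positive only where `f < f x / 2 < 0`, and it has positive integral
  -- even if `x` is an endpoint.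
  let g : ℝ → ℝ := fun y => max 0 (δ - |y - x|)
  have hg : Continuous g := by fun_prop
  have h0 := integral_mul_nonneg_of_rieszFunctional_nonneg hint hf.moment hpos hg
    fun y _ => le_max_left _ _
  have hgpos : 0 < ∫ y in (0 : ℝ)..1, g y :=
    intervalIntegral.integral_pos zero_lt_one hg.continuousOn (fun y _ => le_max_left _ _)
      ⟨x, hx, by simp [g, hδ]⟩
  have hle : ∫ y in (0 : ℝ)..1, g y * f y ≤ ∫ y in (0 : ℝ)..1, g y * (f x / 2) := by
    refine intervalIntegral.integral_mono_on zero_le_one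
      (hint.continuousOn_mul hg.continuousOn)
      ((hg.mul continuous_const).intervalIntegrable _ _) fun y hy => ?_
    rcases lt_or_ge |y - x| δ with hyx | hyx
    · exact mul_le_mul_of_nonneg_left (show f y < f x / 2 from h ⟨hyx, hy⟩).le (le_max_left _ _)
    · have : g y = 0 := max_eq_left (sub_nonpos.2 hyx)
      simp [this]
  rw [intervalIntegral.integral_mul_const] at hle
  have := mul_neg_of_pos_of_neg hgpos (show f x / 2 < 0 by linarith)
  linarith

/-- Truncation changes `f` only at discontinuities, a null set in `[0,1]`, so the moments and the
derivative measures stay the same. -/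
theorem IsRepresentingDensity.max_zero {s : ℕ → ℝ} {f : ℝ → ℝ} (hf : IsRepresentingDensity s f)
    (hpos : ∀ k l : ℕ, 0 ≤ rieszFunctional s (X ^ k * (1 - X) ^ l)) :
    IsRepresentingDensity s fun x => max (f x) 0 := by
  have hae : ∀ᵐ x, x ∈ uIoc (0 : ℝ) 1 → max (f x) 0 = f x := by
    filter_upwards [hf.piecewise_continuous.ae_continuousWithinAt] with x hx hx1
    rw [uIoc_of_le zero_le_one] at hx1
    have hx2 := Ioc_subset_Icc_self hx1
    exact max_eq_left (hf.nonneg_of_continuousWithinAt hpos hx2 (hx hx2))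
  refine ⟨⟨fun x hx => ?_, fun x hx => ?_, ?_⟩, fun i => ?_, ?_⟩
  · obtain ⟨l, hl⟩ := hf.piecewise_continuous.right_limit x hx
    exact ⟨_, hl.max tendsto_const_nhds⟩
  · obtain ⟨l, hl⟩ := hf.piecewise_continuous.left_limit x hx
    exact ⟨_, hl.max tendsto_const_nhds⟩
  · refine hf.piecewise_continuous.countable_discontinuities.mono fun x hx => ?_
    exact ⟨hx.1, fun h => hx.2 (h.max continuousWithinAt_const)⟩
  · rw [hf.moment i]
    refine intervalIntegral.integral_congr_ae ?_
    filter_upwards [hae] with x hx hx1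
    rw [hx hx1]
  · obtain ⟨μ₁, μ₂, h₁, h₂, h₃, h₄, h⟩ := hf.deriv_measure
    refine ⟨μ₁, μ₂, h₁, h₂, h₃, h₄, fun φ hφ hφc => ?_⟩
    rw [← h φ hφ hφc]
    refine intervalIntegral.integral_congr_ae ?_
    filter_upwards [hae] with x hx hx1
    rw [hx hx1]

theorem theorem3p1 (s : ℕ → ℝ) :
    ((∃ f : ℝ → ℝ, IsRepresentingDensity s f) ↔
      ∃ C : ℝ, 0 < C ∧ ∀ d : ℕ,
        ∑ k ∈ Finset.range (d + 1),
          (d.choose k : ℝ) * |rieszFunctional s (X ^ k * (1 - X) ^ (d - k))| < C ∧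
        ∑ k ∈ Finset.range (d + 1),
          (d.choose k : ℝ) * |rieszFunctional (momentDeriv s) (X ^ k * (1 - X) ^ (d - k))| < C) ∧
    ((∀ k l : ℕ, 0 ≤ rieszFunctional s (X ^ k * (1 - X) ^ l)) →
      (∀ f : ℝ → ℝ, IsRepresentingDensity s f →
        ∀ x ∈ Icc (0 : ℝ) 1, ContinuousWithinAt f (Icc 0 1) x → 0 ≤ f x) ∧
      ((∃ f : ℝ → ℝ, IsRepresentingDensity s f) →
        ∃ f : ℝ → ℝ, IsRepresentingDensity s f ∧ ∀ x ∈ Icc (0 : ℝ) 1, 0 ≤ f x)) :=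
  ⟨⟨fun ⟨_, hf⟩ => hf.exists_bound,
      fun ⟨_, _, hC⟩ => exists_isRepresentingDensity fun d => (hC d).2⟩,
    fun hpos => ⟨fun _ hf _ hx hc => hf.nonneg_of_continuousWithinAt hpos hx hc,
      fun ⟨_, hf⟩ => ⟨_, hf.max_zero hpos, fun _ _ => le_max_right _ _⟩⟩⟩
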